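/- Let $B,K_\theta,K_\beta,K_x,\rho$ be real constants and $r$ a nonnegative integer. There are constants $C_0,C_1,c>0$, depending only on $(B,K_\theta,K_\beta,K_x,\rho,r)$, such that the following holds for all integers $n\ge 1$, $m\ge 0$. *Model.* Let $\nu$ be a measure on $\mathbb R$ (the base measure of an exponential family, e.g. counting measure on $\{0,1\}$ for the logistic model) and $b(\eta)=\log\int e^{\eta a}\,d\nu(a)$. Let $x_{ij}\in\mathbb R^m$ $(1\le i,j\le n)$ be covariates, $\Theta=(\theta_{ij})\in\mathbb R^{n\times n}$, $\beta\in\mathbb R^m$, and let $A=(A_{ij})$ be a random $n\times n$ matrix with independent entries such that $A_{ij}$ has density $\exp(\eta_{ij}a-b(\eta_{ij}))$ with respect to $\nu$, where $\eta_{ij}=\theta_{ij}+x_{ij}^\top\beta$. Put $P=\mathbb E[A]$. Assume $$|\theta_{ij}|\le K_\theta,\quad \operatorname{rank}(\Theta)\le r,\quad \|\beta\|_2\le K_\beta,\quad \|x_{ij}\|_2\le K_x\quad\text{for all } i,j,$$ and that the entries are uniformly bounded: $|A_{ij}|\le B$ almost surely for all $i,j$. *Estimators.* For $\Theta'\in\mathbb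 R^{n\times n}$ and $\beta'\in\mathbb R^m$ let $\ell_A(\Theta',\beta')=\sum_{i,j}\big(\eta'_{ij}A_{ij}-b(\eta'_{ij})\big)$, where $\eta'_{ij}=\theta'_{ij}+x_{ij}^\top\beta'$, be the log-likelihood. Let $\sqrt r\,nK_\theta\le R\le\rho n$ (e.g. $R=\sqrt r\,nK_\theta$), let $s\ge r$ be an integer, and let $\mathcal B\subseteq\mathbb R^m$ be any set containing $\beta$ (e.g. the ball $\{\|\beta'\|_2\le K_\beta\}$, or $\mathbb R^m$). Let $(\widetilde\Theta,\widetilde\beta)$ be a maximizer of $\ell_A$ over $\{(\Theta',\beta'):\|\Theta'\|_*\le R,\ \beta'\in\mathcal B\}$ and $(\widehat\Theta,\widehat\beta)$ a maximizer of $\ell_A$ over $\{(\Theta',\beta'):\|\Theta'\|_*\le R,\ \operatorname{rank}(\Theta')\le s,\ \beta'\in\mathcal B\}$, where $\|\cdot\|_*$ is the nuclear norm. Let $\widetilde P$ and $\widehat P$ have entries $b'(\widetilde\theta_{ij}+x_{ij}^\top\widetilde\beta)$ and $b'(\widehat\theta_{ij}+x_{ij}^\top\widehat\beta)$. *Conclusion.*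 Both scaled errors have exponentially decaying tail probabilities: for every $t>0$, $$\mathbb P\Big(\|\widetilde\beta\|_2\le K_\beta,\ n^{-1}\|\widetilde P-P\|_F\ge t\Big)\le C_1\exp\Big(-c\,\big(nt^2-C_0\sqrt n\big)_+^2\Big),$$ $$\mathbb P\Big(\|\widehat\beta\|_2\le K_\beta,\ n^{-1}\|\widehat P-P\|_F\ge t\Big)\le C_1\exp\Big(-c\,\big(nt^2-C_0\sqrt n\big)_+^2\Big).$$ The bounds hold for the event that some maximizer has the stated property, hence for every choice of maximizers. When $\mathcal B=\{\|\beta'\|_2\le K_\beta\}$, the restriction $\|\widetilde\beta\|_2\le K_\beta$ (resp. $\|\widehat\beta\|_2\le K_\beta$) is automatic. -/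

import Mathlib

open MeasureTheory ProbabilityTheory

noncomputable section

namespace LowRankGLM

/-- The Frobenius norm of a real square matrix. -/
def frobNorm {n : ℕ} (M : Matrix (Fin n) (Fin n) ℝ) : ℝ :=
  Real.sqrt (∑ i, ∑ j, M i j ^ 2)

/-- The nuclear norm of a real square matrix: the sum of its singular values. -/
def nuclearNorm {n : ℕ} (M : Matrix (Fin n) (Fin n) ℝ) : ℝ :=
  ∑ k ∈ Finset.range n, (Matrix.toEuclideanLin M).singularValues k

/-- The log-partition function `b η = log ∫ exp (η * a) dν a` of the natural exponential family
with base measure `ν`; in the notation of densities, `dν = c dμ` with `μ` the Lebesgue or the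
counting measure. -/
def logPartition (ν : Measure ℝ) (η : ℝ) : ℝ :=
  cgf id ν η

/-- The member of the natural exponential family with base measure `ν` and natural parameter `η`:
the law with density `exp (η * a - b η)` with respect to `ν`. -/
def expFamily (ν : Measure ℝ) (η : ℝ) : Measure ℝ :=
  ν.tilted (fun a => η * a)

/-- The inverse canonical link `b'`. -/
def invLink (ν : Measure ℝ) (η : ℝ) : ℝ :=
  deriv (logPartition ν) η

/-- The matrix of linear predictors, with entries `Θ i j + ⟨x i j, β⟩`. -/
def linPred {n m : ℕ} (x : Fin n → Fin n → EuclideanSpace ℝ (Fin m))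
    (Θ : Matrix (Fin n) (Fin n) ℝ) (β : EuclideanSpace ℝ (Fin m)) : Matrix (Fin n) (Fin n) ℝ :=
  Matrix.of fun i j => Θ i j + ∑ k, x i j k * β k

/-- The mean matrix `b' (Θ + X ⊗ β)` (entrywise) that corresponds to the parameters `(Θ, β)`. -/
def fittedMean {n m : ℕ} (ν : Measure ℝ) (x : Fin n → Fin n → EuclideanSpace ℝ (Fin m))
    (Θ : Matrix (Fin n) (Fin n) ℝ) (β : EuclideanSpace ℝ (Fin m)) : Matrix (Fin n) (Fin n) ℝ :=
  (linPred x Θ β).map (invLink ν)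

/-- The log-likelihood of `(Θ, β)` given the observed adjacency matrix `A`, i.e. the logarithm of
the joint density of the entries with respect to the product of copies of `ν`. (A density with
respect to another dominating measure changes it by a term that depends on `A` only.) -/
def logLik {n m : ℕ} (ν : Measure ℝ) (x : Fin n → Fin n → EuclideanSpace ℝ (Fin m))
    (A : Matrix (Fin n) (Fin n) ℝ)
    (p : Matrix (Fin n) (Fin n) ℝ × EuclideanSpace ℝ (Fin m)) : ℝ :=
  ∑ i, ∑ j, (linPred x p.1 p.2 i j * A i j - logPartition ν (linPred x p.1 p.2 i j))

/-- `p = (Θ', β')` maximizes the log-likelihood over the feasible set `F`. -/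
def IsMaximizer {n m : ℕ} (ν : Measure ℝ) (x : Fin n → Fin n → EuclideanSpace ℝ (Fin m))
    (A : Matrix (Fin n) (Fin n) ℝ)
    (F : Set (Matrix (Fin n) (Fin n) ℝ × EuclideanSpace ℝ (Fin m)))
    (p : Matrix (Fin n) (Fin n) ℝ × EuclideanSpace ℝ (Fin m)) : Prop :=
  p ∈ F ∧ ∀ q ∈ F, logLik ν x A q ≤ logLik ν x A p

/-- The feasible set of the convex relaxation: `Θ` has nuclear norm at most `R`, and the
coefficient vector lies in `𝓑`. -/
def relaxedSet {m : ℕ} (n : ℕ) (R : ℝ) (𝓑 : Set (EuclideanSpace ℝ (Fin m))) :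
    Set (Matrix (Fin n) (Fin n) ℝ × EuclideanSpace ℝ (Fin m)) :=
  {p | nuclearNorm p.1 ≤ R ∧ p.2 ∈ 𝓑}

/-- The feasible set of the rank-truncated criterion: `Θ` has nuclear norm at most `R` and rank at
most `s`, and the coefficient vector lies in `𝓑`. -/
def truncatedSet {m : ℕ} (n : ℕ) (R : ℝ) (s : ℕ) (𝓑 : Set (EuclideanSpace ℝ (Fin m))) :
    Set (Matrix (Fin n) (Fin n) ℝ × EuclideanSpace ℝ (Fin m)) :=
  {p | nuclearNorm p.1 ≤ R ∧ p.1.rank ≤ s ∧ p.2 ∈ 𝓑}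

/-- The matrix of expectations of a random matrix. -/
def meanMatrix {n : ℕ} {Ω : Type*} [MeasurableSpace Ω] (μ : Measure Ω)
    (A : Ω → Matrix (Fin n) (Fin n) ℝ) : Matrix (Fin n) (Fin n) ℝ :=
  Matrix.of fun i j => ∫ ω, A ω i j ∂μ

/-- The generalized linear model for the random adjacency matrix `A`, with true parameters
`(Θ, β)`: the entries are independent, and the `(i, j)` entry follows the exponential family with
base measure `ν` and natural parameter `Θ i j + ⟨x i j, β⟩`. -/
structure IsGLM {n m : ℕ} {Ω : Type*} [MeasurableSpace Ω] (μ : Measure Ω) (ν : Measure ℝ)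
    (x : Fin n → Fin n → EuclideanSpace ℝ (Fin m)) (Θ : Matrix (Fin n) (Fin n) ℝ)
    (β : EuclideanSpace ℝ (Fin m)) (A : Ω → Matrix (Fin n) (Fin n) ℝ) : Prop where
  measurable : ∀ i j, Measurable fun ω => A ω i j
  indep : iIndepFun (fun (e : Fin n × Fin n) (ω : Ω) => A ω e.1 e.2) μ
  law : ∀ i j, μ.map (fun ω => A ω i j) = expFamily ν (linPred x Θ β i j)

/-- The scaled Frobenius error `n⁻¹ ‖b' (Θ' + X ⊗ β') - P‖_F` of a pair `p = (Θ', β')`. -/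
def scaledError {n m : ℕ} (ν : Measure ℝ) (x : Fin n → Fin n → EuclideanSpace ℝ (Fin m))
    (P : Matrix (Fin n) (Fin n) ℝ)
    (p : Matrix (Fin n) (Fin n) ℝ × EuclideanSpace ℝ (Fin m)) : ℝ :=
  (n : ℝ)⁻¹ * frobNorm (fittedMean ν x p.1 p.2 - P)

end LowRankGLM

end

/-! Write D = A - P. Maximality against the true parameters bounds the total Bregman divergence of b
by the pairing of D with the error of the linear predictor. Bounded entries make b convex and
B²-smooth, so b' is cocoercive (`sq_invLink_sub_le`) and the squared Frobenius error of the means is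
at most 2B² times that pairing (`frobNorm_sq_le_of_isMaximizer`). No lower bound on the curvature of
b is needed.

The pairing splits into a matrix part, at most 2R‖D‖ in operator norm by duality with the nuclear
norm, and a covariate part, at most 2Kβ‖∑ D_ij x_ij‖. A net argument and a tail bound free of the
dimension m control both at scale w, outside probability 4·25^n·exp(-w²/(2B²))
(`IsGLM.exists_exceptional_set`). Taking w proportional to nt² and absorbing 25^n into the shift
C₀√n gives the tail.

Of the feasible set, only two properties matter: it contains the truth and its nuclear norms are at
most R. Both estimators are thus covered at once. -/

namespace LowRankGLM

/-! ### Convexity and smoothness of the log-partition function -/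

section ExponentialFamily

variable {ν : Measure ℝ} {B : ℝ}

lemma integrable_exp_mul_of_abs_le [IsFiniteMeasure ν] (hB : ∀ᵐ a ∂ν, |a| ≤ B) (t : ℝ) :
    Integrable (fun a => Real.exp (t * a)) ν :=
  integrable_exp_mul_of_mem_Icc (X := fun a : ℝ => a) (a := -B) (b := B) aemeasurable_id
    (hB.mono fun _ ha => abs_le.1 ha)

lemma isProbabilityMeasure_expFamily [IsFiniteMeasure ν] [NeZero ν] (hB : ∀ᵐ a ∂ν, |a| ≤ B)
    (y : ℝ) : IsProbabilityMeasure (expFamily ν y) :=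
  isProbabilityMeasure_tilted (integrable_exp_mul_of_abs_le hB y)

lemma ae_abs_le_expFamily (hB : ∀ᵐ a ∂ν, |a| ≤ B) (y : ℝ) : ∀ᵐ a ∂expFamily ν y, |a| ≤ B :=
  (tilted_absolutelyContinuous ν _).ae_le hB

lemma integral_expFamily [IsFiniteMeasure ν] (hB : ∀ᵐ a ∂ν, |a| ≤ B) (y : ℝ) :
    ∫ a, a ∂expFamily ν y = invLink ν y := by
  have h : integrableExpSet id ν = Set.univ :=
    Set.eq_univ_of_forall fun t => integrable_exp_mul_of_abs_le hB t
  exact integral_tilted_mul_self (X := id) (by simp [h])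

lemma mgf_expFamily [IsFiniteMeasure ν] [NeZero ν] (hB : ∀ᵐ a ∂ν, |a| ≤ B) (y h : ℝ) :
    mgf id (expFamily ν y) h = Real.exp (logPartition ν (y + h) - logPartition ν y) := by
  rw [Real.exp_sub, logPartition, logPartition,
    exp_cgf (X := id) (integrable_exp_mul_of_abs_le hB _),
    exp_cgf (X := id) (integrable_exp_mul_of_abs_le hB _), mgf, expFamily]
  simp only [id]
  rw [integral_exp_tilted]
  simp [mgf, add_mul]

lemma hasSubgaussianMGF_expFamily [IsFiniteMeasure ν] [NeZero ν] (hB0 : 0 ≤ B)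
    (hB : ∀ᵐ a ∂ν, |a| ≤ B) (y : ℝ) :
    HasSubgaussianMGF (fun a => a - invLink ν y) (B.toNNReal ^ 2) (expFamily ν y) := by
  have := isProbabilityMeasure_expFamily hB y
  have h := hasSubgaussianMGF_of_mem_Icc (X := fun a : ℝ => a) (a := -B) (b := B)
    (μ := expFamily ν y) aemeasurable_id
    ((ae_abs_le_expFamily hB y).mono fun _ ha => abs_le.1 ha)
  rw [integral_expFamily hB] at h
  convert h using 2
  ext
  simp [hB0, abs_of_nonneg (add_nonneg hB0 hB0)]

/-- The exponent is a Bregman divergence of b, so bounds on the centred moment generating function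
become bounds on b: Hoeffding's lemma yields smoothness, and exp u ≥ 1 + u yields convexity. -/
lemma mgf_sub_invLink [IsFiniteMeasure ν] [NeZero ν] (hB : ∀ᵐ a ∂ν, |a| ≤ B) (y h : ℝ) :
    mgf (fun a => a - invLink ν y) (expFamily ν y) h =
      Real.exp (logPartition ν (y + h) - logPartition ν y - h * invLink ν y) := by
  rw [Real.exp_sub, ← mgf_expFamily hB]
  simp only [mgf, mul_sub, Real.exp_sub, id, integral_div]

lemma logPartition_le [IsFiniteMeasure ν] [NeZero ν] (hB0 : 0 ≤ B) (hB : ∀ᵐ a ∂ν, |a| ≤ B)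
    (y z : ℝ) : logPartition ν z ≤
      logPartition ν y + invLink ν y * (z - y) + B ^ 2 * (z - y) ^ 2 / 2 := by
  have h := (hasSubgaussianMGF_expFamily hB0 hB y).mgf_le (z - y)
  rw [mgf_sub_invLink hB, Real.exp_le_exp] at h
  simp only [add_sub_cancel, NNReal.coe_pow, Real.coe_toNNReal _ hB0] at h
  linarith

lemma le_logPartition [IsFiniteMeasure ν] [NeZero ν] (hB : ∀ᵐ a ∂ν, |a| ≤ B) (y z : ℝ) :
    logPartition ν y + invLink ν y * (z - y) ≤ logPartition ν z := by
  have := isProbabilityMeasure_expFamily hB y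
  have hint : Integrable (fun a : ℝ => a) (expFamily ν y) :=
    Integrable.of_mem_Icc (-B) B aemeasurable_id
      ((ae_abs_le_expFamily hB y).mono fun _ ha => abs_le.1 ha)
  have hexp := integrable_exp_mul_of_abs_le (ae_abs_le_expFamily hB y) (z - y)
  have hlin : Integrable (fun a => (z - y) * (a - invLink ν y)) (expFamily ν y) :=
    (hint.sub (integrable_const _)).const_mul _
  have h : 1 ≤ mgf (fun a => a - invLink ν y) (expFamily ν y) (z - y) := by
    calc (1 : ℝ) = ∫ a, ((z - y) * (a - invLink ν y) + 1) ∂expFamily ν y := by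
          rw [integral_add hlin (integrable_const _), integral_const_mul,
            integral_sub hint (by fun_prop), integral_expFamily hB]
          simp
      _ ≤ _ := by
          refine integral_mono (hlin.add (integrable_const _)) ?_ fun a => Real.add_one_le_exp _
          simp only [mul_sub, Real.exp_sub]
          exact hexp.div_const _
  rw [mgf_sub_invLink hB, Real.one_le_exp_iff, add_sub_cancel] at h
  linarith

/-- Cocoercivity of the inverse link. -/
lemma sq_invLink_sub_le [IsFiniteMeasure ν] [NeZero ν] (hB0 : 0 < B) (hB : ∀ᵐ a ∂ν, |a| ≤ B)
    (x y : ℝ) : (invLink ν y - invLink ν x) ^ 2 ≤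
      2 * B ^ 2 * (logPartition ν y - logPartition ν x - invLink ν x * (y - x)) := by
  set d := invLink ν y - invLink ν x with hd
  -- The point y - d/B² is a gradient step for b minus its tangent at x. There the tangent at x lies
  -- below the parabola at y.
  have h1 := le_logPartition hB x (y - d / B ^ 2)
  have h2 := logPartition_le hB0.le hB y (y - d / B ^ 2)
  have h3 : d ^ 2 / (2 * B ^ 2) ≤
      logPartition ν y - logPartition ν x - invLink ν x * (y - x) := by
    have e1 : B ^ 2 * (y - d / B ^ 2 - y) ^ 2 / 2 = d ^ 2 / (2 * B ^ 2) := by field_simp; ring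
    have e2 : invLink ν y * (y - d / B ^ 2 - y) =
        invLink ν x * (y - d / B ^ 2 - y) - 2 * (d ^ 2 / (2 * B ^ 2)) := by
      rw [show invLink ν y = invLink ν x + d by rw [hd]; ring]; field_simp; ring
    rw [e1, e2] at h2
    linarith
  rwa [div_le_iff₀' (by positivity)] at h3

/-- A base measure with a bounded member in its exponential family is finite, nonzero and
bounded. -/
lemma base_of_expFamily {y : ℝ} (hp : IsProbabilityMeasure (expFamily ν y))
    (hB : ∀ᵐ a ∂expFamily ν y, |a| ≤ B) :
    IsFiniteMeasure ν ∧ NeZero ν ∧ ∀ᵐ a ∂ν, |a| ≤ B := by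
  -- A tilt by a non-integrable weight is the zero measure by convention, which is not a probability
  -- measure.
  have hint : Integrable (fun a => Real.exp (y * a)) ν := by
    by_contra h
    exact hp.ne_zero _ (tilted_of_not_integrable h)
  have hBν : ∀ᵐ a ∂ν, |a| ≤ B := (absolutelyContinuous_tilted hint).ae_le hB
  refine ⟨?_, ⟨fun h => hp.ne_zero _ (by rw [expFamily, h, tilted_zero_measure])⟩, hBν⟩
  have h1 : Integrable (fun _ : ℝ => (1 : ℝ)) ν := by
    refine (hint.const_mul (Real.exp (|y| * B))).mono' (by fun_prop) ?_
    filter_upwards [hBν] with a ha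
    rw [← Real.exp_add, norm_one, Real.one_le_exp_iff]
    have : -(|y| * |a|) ≤ y * a := by rw [← abs_mul]; exact neg_abs_le _
    nlinarith [abs_nonneg y]
  exact (integrable_const_iff_isFiniteMeasure one_ne_zero).1 h1

end ExponentialFamily

end LowRankGLM

namespace LowRankGLM

/-! ### Nuclear norm, trace duality and nets -/

section Matrices

open Module

/-- Both sides are the trace of S*T. This allows the Frobenius pairing to be computed in a basis of
right singular vectors. -/
lemma sum_inner_eq_sum_inner {E ι κ : Type*} [NormedAddCommGroup E] [InnerProductSpace ℝ E]
    [FiniteDimensional ℝ E] [Fintype ι] [Fintype κ] (b : OrthonormalBasis ι ℝ E)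
    (b' : OrthonormalBasis κ ℝ E) (S T : E →ₗ[ℝ] E) :
    ∑ i, inner ℝ (S (b i)) (T (b i)) = ∑ i, inner ℝ (S (b' i)) (T (b' i)) := by
  trans LinearMap.trace ℝ E (S.adjoint ∘ₗ T)
  · rw [LinearMap.trace_eq_sum_inner _ b]
    simp [LinearMap.adjoint_inner_right]
  · rw [LinearMap.trace_eq_sum_inner _ b']
    simp [LinearMap.adjoint_inner_right]

lemma sum_inner_toEuclideanLin {n : ℕ} (M N : Matrix (Fin n) (Fin n) ℝ) :
    ∑ j, inner ℝ (Matrix.toEuclideanLin M (EuclideanSpace.basisFun (Fin n) ℝ j))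
      (Matrix.toEuclideanLin N (EuclideanSpace.basisFun (Fin n) ℝ j)) =
      ∑ i, ∑ j, M i j * N i j := by
  rw [Finset.sum_comm]
  simp [PiLp.inner_apply, Matrix.toLpLin_apply, mul_comm]

/-- An eigenbasis of T*T works; a full singular value decomposition is not needed. -/
lemma exists_orthonormalBasis_norm_eq_singularValues {n : ℕ} (T : EuclideanSpace ℝ (Fin n) →ₗ[ℝ]
    EuclideanSpace ℝ (Fin n)) : ∃ b : OrthonormalBasis (Fin n) ℝ (EuclideanSpace ℝ (Fin n)),
      ∀ k, ‖T (b k)‖ = T.singularValues k := by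
  have hn : finrank ℝ (EuclideanSpace ℝ (Fin n)) = n := by simp
  refine ⟨T.isSymmetric_adjoint_comp_self.eigenvectorBasis hn, fun k => ?_⟩
  have h := T.isSymmetric_adjoint_comp_self.apply_eigenvectorBasis hn k
  rw [← sq_eq_sq₀ (norm_nonneg _) (T.singularValues_nonneg k), T.sq_singularValues_fin hn k,
    ← real_inner_self_eq_norm_sq, ← LinearMap.adjoint_inner_right, ← LinearMap.comp_apply, h,
    inner_smul_right, real_inner_self_eq_norm_sq]
  simp

/-- Duality between the operator norm and the nuclear norm. -/
lemma sum_mul_le_mul_nuclearNorm {n : ℕ} (M Θ : Matrix (Fin n) (Fin n) ℝ) {c : ℝ}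
    (hc : ∀ v, ‖Matrix.toEuclideanLin M v‖ ≤ c * ‖v‖) :
    ∑ i, ∑ j, M i j * Θ i j ≤ c * nuclearNorm Θ := by
  obtain ⟨b, hb⟩ := exists_orthonormalBasis_norm_eq_singularValues (Matrix.toEuclideanLin Θ)
  rw [← sum_inner_toEuclideanLin, sum_inner_eq_sum_inner _ b, nuclearNorm, Finset.sum_range,
    Finset.mul_sum]
  refine Finset.sum_le_sum fun k _ => (real_inner_le_norm _ _).trans ?_
  rw [hb]
  refine mul_le_mul_of_nonneg_right ?_ (LinearMap.singularValues_nonneg _ _)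
  simpa using hc (b k)

lemma sum_singularValues_sq {n : ℕ} (Θ : Matrix (Fin n) (Fin n) ℝ) :
    ∑ k ∈ Finset.range n, (Matrix.toEuclideanLin Θ).singularValues k ^ 2 =
      ∑ i, ∑ j, Θ i j ^ 2 := by
  obtain ⟨b, hb⟩ := exists_orthonormalBasis_norm_eq_singularValues (Matrix.toEuclideanLin Θ)
  have h := sum_inner_toEuclideanLin Θ Θ
  rw [sum_inner_eq_sum_inner _ b] at h
  simp_rw [real_inner_self_eq_norm_sq, hb, ← sq] at h
  rw [Finset.sum_range, h]

/-- Cauchy–Schwarz over the nonzero singular values, whose number is the rank. -/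
lemma nuclearNorm_le_sqrt_rank_mul_frobNorm {n : ℕ} (Θ : Matrix (Fin n) (Fin n) ℝ) :
    nuclearNorm Θ ≤ Real.sqrt Θ.rank * frobNorm Θ := by
  set T := Matrix.toEuclideanLin Θ with hT
  have hrank : finrank ℝ T.range = Θ.rank := by
    rw [Matrix.rank_eq_finrank_range_toLin Θ (EuclideanSpace.basisFun (Fin n) ℝ).toBasis
      (EuclideanSpace.basisFun (Fin n) ℝ).toBasis, hT, Matrix.toEuclideanLin_eq_toLin_orthonormal]
  have hle : Θ.rank ≤ n := by simpa using Θ.rank_le_width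
  have hsum : nuclearNorm Θ = ∑ k ∈ Finset.range Θ.rank, T.singularValues k := by
    refine (Finset.sum_subset (Finset.range_mono hle) fun k _ hk => ?_).symm
    rw [LinearMap.singularValues_eq_zero_iff_le_finrank_range, hrank]
    simpa using hk
  rw [frobNorm, ← Real.sqrt_mul (by positivity)]
  refine Real.le_sqrt_of_sq_le ?_
  rw [hsum, ← sum_singularValues_sq]
  refine sq_sum_le_card_mul_sum_sq.trans ?_
  rw [Finset.card_range]
  refine mul_le_mul_of_nonneg_left ?_ (Nat.cast_nonneg _)
  exact Finset.sum_le_sum_of_subset_of_nonneg (Finset.range_mono hle) fun _ _ _ => sq_nonneg _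

lemma frobNorm_le_mul {n : ℕ} {Θ : Matrix (Fin n) (Fin n) ℝ} {K : ℝ} (hK : 0 ≤ K)
    (hΘ : ∀ i j, |Θ i j| ≤ K) : frobNorm Θ ≤ n * K := by
  refine Real.sqrt_le_iff.2 ⟨by positivity, ?_⟩
  calc ∑ i, ∑ j, Θ i j ^ 2 ≤ ∑ _i : Fin n, ∑ _j : Fin n, K ^ 2 := by
        refine Finset.sum_le_sum fun i _ => Finset.sum_le_sum fun j _ => ?_
        exact sq_le_sq' (abs_le.1 (hΘ i j)).1 (abs_le.1 (hΘ i j)).2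
    _ = (n * K) ^ 2 := by simp; ring

lemma exists_half_net (E : Type*) [NormedAddCommGroup E] [NormedSpace ℝ E]
    [FiniteDimensional ℝ E] :
    ∃ N : Finset E, N.card ≤ 5 ^ finrank ℝ E ∧ (∀ u ∈ N, ‖u‖ ≤ 1) ∧
      ∀ v : E, ‖v‖ ≤ 1 → ∃ u ∈ N, ‖v - u‖ ≤ 1 / 2 := by
  classical
  let Sep (s : Finset E) : Prop :=
    (∀ u ∈ s, ‖u‖ ≤ 1) ∧ ∀ u ∈ s, ∀ v ∈ s, u ≠ v → 1 / 2 ≤ ‖u - v‖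
  have hcard (s : Finset E) (hs : Sep s) : s.card ≤ 5 ^ finrank ℝ E := by
    -- Doubling turns a 1/2-separated set in the unit ball into a 1-separated set in the ball of
    -- radius 2, the setting of the 5^d packing bound.
    have hinj : Function.Injective fun u : E => (2 : ℝ) • u := smul_right_injective _ two_ne_zero
    rw [← Finset.card_image_of_injective s hinj]
    refine Besicovitch.card_le_of_separated _ ?_ ?_
    · simp only [Finset.forall_mem_image, norm_smul, Real.norm_two]
      intro u hu
      linarith [hs.1 u hu]
    · simp only [Finset.forall_mem_image, ← smul_sub, norm_smul, Real.norm_two]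
      intro u hu v hv huv
      linarith [hs.2 u hu v hv (fun h => huv (by rw [h]))]
  -- A separated set of maximal cardinality is a net: a point far from it could be inserted.
  have hne : {k | ∃ s, Sep s ∧ s.card = k}.Nonempty := ⟨0, ∅, ⟨by simp, by simp⟩, rfl⟩
  have hbdd : BddAbove {k | ∃ s, Sep s ∧ s.card = k} :=
    ⟨5 ^ finrank ℝ E, by rintro _ ⟨s, hs, rfl⟩; exact hcard s hs⟩
  obtain ⟨N, hN, hNcard⟩ := Nat.sSup_mem hne hbdd
  refine ⟨N, hcard N hN, hN.1, fun v hv => ?_⟩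
  by_contra! hfar
  have hvN : v ∉ N := fun h => by have := hfar v h; norm_num at this
  have hins : Sep (insert v N) := by
    refine ⟨fun u hu => ?_, fun u hu w hw huw => ?_⟩
    · rcases Finset.mem_insert.1 hu with rfl | hu
      exacts [hv, hN.1 u hu]
    · rcases Finset.mem_insert.1 hu with hu | hu <;> rcases Finset.mem_insert.1 hw with hw | hw
      · exact absurd (hu.trans hw.symm) huw
      · exact hu ▸ (hfar w hw).le
      · rw [norm_sub_rev]; exact hw ▸ (hfar u hu).le
      · exact hN.2 u hu w hw huw
  have := le_csSup hbdd ⟨_, hins, rfl⟩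
  rw [Finset.card_insert_of_notMem hvN, ← hNcard] at this
  omega

lemma norm_apply_le_of_net {E F : Type*} [NormedAddCommGroup E] [NormedSpace ℝ E]
    [NormedAddCommGroup F] [NormedSpace ℝ F] {N : Finset E}
    (hN : ∀ v : E, ‖v‖ ≤ 1 → ∃ u ∈ N, ‖v - u‖ ≤ 1 / 2) (T : E →L[ℝ] F) {w : ℝ} (hw : ∀ u ∈ N, ‖T u‖ ≤ w) (v : E) : ‖T v‖ ≤ 2 * w * ‖v‖ := by
  have h : ‖T‖ ≤ 2 * w := by
    have hw0 : 0 ≤ w := by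
      obtain ⟨u, hu, -⟩ := hN 0 (by simp)
      exact (norm_nonneg _).trans (hw u hu)
    have : ‖T‖ ≤ w + ‖T‖ / 2 := by
      refine T.opNorm_le_of_unit_norm (by positivity) fun v hv => ?_
      obtain ⟨u, hu, huv⟩ := hN v hv.le
      calc ‖T v‖ = ‖T u + T (v - u)‖ := by rw [← map_add]; congr 1; abel_nf
        _ ≤ ‖T u‖ + ‖T‖ * ‖v - u‖ := (norm_add_le _ _).trans (by gcongr; exact T.le_opNorm _)
        _ ≤ w + ‖T‖ / 2 := by
          have := mul_le_mul_of_nonneg_left huv (norm_nonneg T)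
          linarith [hw u hu]
    linarith
  exact (T.le_opNorm v).trans (by gcongr)

/-- The net is used once on each side, and each use costs a factor 2. For the left side, the
functional ⟨y, ·⟩ is evaluated at y = Mv itself. -/
lemma norm_toEuclideanLin_le_of_net {n : ℕ} {N : Finset (EuclideanSpace ℝ (Fin n))}
    (hN : ∀ v, ‖v‖ ≤ 1 → ∃ u ∈ N, ‖v - u‖ ≤ 1 / 2) (M : Matrix (Fin n) (Fin n) ℝ) {w : ℝ}
    (hw : ∀ u ∈ N, ∀ v ∈ N, |∑ i, ∑ j, u i * v j * M i j| ≤ w) (v : EuclideanSpace ℝ (Fin n)) :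
    ‖Matrix.toEuclideanLin M v‖ ≤ 4 * w * ‖v‖ := by
  have h : ∀ v ∈ N, ‖(Matrix.toEuclideanLin M).toContinuousLinearMap v‖ ≤ 2 * w := by
    intro v hv
    set y := Matrix.toEuclideanLin M v with hy
    have := norm_apply_le_of_net hN (innerSL ℝ y) (w := w) (fun u hu => by
      refine le_trans (le_of_eq ?_) (hw u hu v hv)
      simp only [innerSL_apply_apply, Real.norm_eq_abs, PiLp.inner_apply, hy,
        Matrix.toLpLin_apply, Matrix.mulVec, dotProduct, RCLike.inner_apply, conj_trivial,
        Finset.mul_sum]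
      congr 1
      refine Finset.sum_congr rfl fun i _ => Finset.sum_congr rfl fun j _ => ?_
      ring) y
    rw [innerSL_apply_apply, real_inner_self_eq_norm_sq, Real.norm_eq_abs, abs_sq, sq] at this
    rcases (norm_nonneg y).eq_or_lt with h0 | h0
    · have hw0 : 0 ≤ w := (abs_nonneg _).trans (hw v hv v hv)
      change ‖y‖ ≤ 2 * w
      linarith
    · exact le_of_mul_le_mul_right this h0
  have := norm_apply_le_of_net hN _ h v
  rw [show 4 * w = 2 * (2 * w) by ring]
  exact this

end Matrices

end LowRankGLM

namespace LowRankGLM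

/-! ### Sub-Gaussian tails without dependence on the dimension -/

section Concentration

open NNReal

/-- Convexity of `cosh ∘ √`, in the form of Jensen's inequality. -/
lemma cosh_le_sum_mul_cosh {ι : Type*} [Fintype ι] {w z : ι → ℝ} {y : ℝ} (hw : ∀ k, 0 ≤ w k)
    (hw1 : ∑ k, w k = 1) (hy : y ^ 2 = ∑ k, w k * z k ^ 2) :
    Real.cosh y ≤ ∑ k, w k * Real.cosh (z k) := by
  refine hasSum_le (fun n => ?_) y.hasSum_cosh
    (hasSum_sum fun k _ => (z k).hasSum_cosh.mul_left (w k))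
  -- The series of cosh has only even powers, so the power mean inequality for the squares applies
  -- term by term.
  have h := Real.pow_arith_mean_le_arith_mean_pow Finset.univ w (fun k => z k ^ 2)
    (fun k _ => hw k) hw1 (fun k _ => sq_nonneg _) n
  simp only [← hy, ← pow_mul] at h
  calc y ^ (2 * n) / ((2 * n).factorial : ℝ)
      ≤ (∑ k, w k * z k ^ (2 * n)) / ((2 * n).factorial : ℝ) := by gcongr
    _ = _ := by rw [Finset.sum_div]; simp only [mul_div_assoc]

variable {Ω ι : Type*} [MeasurableSpace Ω] [Fintype ι] {μ : Measure Ω} {ξ : ι → Ω → ℝ} {c : ℝ≥0}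

lemma hasSubgaussianMGF_sum_mul (hind : iIndepFun ξ μ)
    (hξ : ∀ e, HasSubgaussianMGF (ξ e) c μ) (a : ι → ℝ) :
    HasSubgaussianMGF (fun ω => ∑ e, a e * ξ e ω) (∑ e, ⟨a e ^ 2, sq_nonneg _⟩ * c) μ :=
  HasSubgaussianMGF.sum_of_iIndepFun
    (hind.comp (fun e y => a e * y) fun _ => measurable_const_mul _)
    fun e _ => (hξ e).const_mul (a e)

lemma mgf_sum_mul_le (hind : iIndepFun ξ μ) (hξ : ∀ e, HasSubgaussianMGF (ξ e) c μ)
    (a : ι → ℝ) {V : ℝ} (hV : ∑ e, a e ^ 2 ≤ V) (t : ℝ) :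
    mgf (fun ω => ∑ e, a e * ξ e ω) μ t ≤ Real.exp (V * c * t ^ 2 / 2) := by
  refine ((hasSubgaussianMGF_sum_mul hind hξ a).mgf_le t).trans (Real.exp_le_exp.2 ?_)
  have : ((∑ e, ⟨a e ^ 2, sq_nonneg _⟩ * c : ℝ≥0) : ℝ) = (∑ e, a e ^ 2) * c := by
    simp only [NNReal.coe_sum, Finset.sum_mul]
    rfl
  rw [this]
  gcongr

lemma integrable_cosh_sum_mul (hind : iIndepFun ξ μ) (hξ : ∀ e, HasSubgaussianMGF (ξ e) c μ)
    (a : ι → ℝ) (t : ℝ) : Integrable (fun ω => Real.cosh (t * ∑ e, a e * ξ e ω)) μ := by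
  have h := (hasSubgaussianMGF_sum_mul hind hξ a).integrable_exp_mul
  refine (((h t).add (h (-t))).div_const 2).congr (.of_forall fun ω => ?_)
  simp [Real.cosh_eq]

lemma integral_cosh_sum_mul_le (hind : iIndepFun ξ μ) (hξ : ∀ e, HasSubgaussianMGF (ξ e) c μ)
    (a : ι → ℝ) {V : ℝ} (hV : ∑ e, a e ^ 2 ≤ V) (t : ℝ) :
    ∫ ω, Real.cosh (t * ∑ e, a e * ξ e ω) ∂μ ≤ Real.exp (V * c * t ^ 2 / 2) := by
  have h := (hasSubgaussianMGF_sum_mul hind hξ a).integrable_exp_mul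
  have h1 := mgf_sum_mul_le hind hξ a hV t
  have h2 := mgf_sum_mul_le hind hξ a hV (-t)
  simp only [Real.cosh_eq, ← neg_mul]
  rw [integral_div, integral_add (h t) (h (-t))]
  rw [neg_sq] at h2
  simp only [mgf] at h1 h2
  linarith

/-- Dimension-free sub-Gaussian tail bound for the norm of a sum of fixed vectors with independent
sub-Gaussian coefficients. -/
lemma measureReal_le_norm_sum_smul {m : ℕ} (hind : iIndepFun ξ μ)
    (hξ : ∀ e, HasSubgaussianMGF (ξ e) c μ) (hc : 0 < c) (x : ι → EuclideanSpace ℝ (Fin m))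
    {V : ℝ} (hV0 : 0 < V) (hV : ∑ e, ‖x e‖ ^ 2 ≤ V) {u : ℝ} (hu : 0 < u) :
    μ.real {ω | u ≤ ‖∑ e, ξ e ω • x e‖} ≤ 2 * Real.exp (-u ^ 2 / (2 * (V * c))) := by
  have := hind.isProbabilityMeasure
  set T : Fin m → ℝ := fun k => ∑ e, x e k ^ 2 with hT
  set V₁ := ∑ e, ‖x e‖ ^ 2 with hV₁
  have hTsum : ∑ k, T k = V₁ := by
    rw [hV₁, hT, Finset.sum_comm]
    simp [EuclideanSpace.real_norm_sq_eq]
  have hT0 : ∀ k, 0 ≤ T k := fun k => Finset.sum_nonneg fun _ _ => sq_nonneg _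
  rcases (show 0 ≤ V₁ from Finset.sum_nonneg fun _ _ => sq_nonneg _).eq_or_lt with h0 | hpos
  · have hx : ∀ e, x e = 0 := fun e => by
      have := (Finset.sum_eq_zero_iff_of_nonneg fun e _ => sq_nonneg ‖x e‖).1 h0.symm e
        (Finset.mem_univ e)
      simpa using this
    have hempty : {ω | u ≤ ‖∑ e, ξ e ω • x e‖} = ∅ := by
      ext ω
      simp [hx, hu]
    rw [hempty]
    simp only [measureReal_empty]
    positivity
  -- The minimizer of the Chernoff exponent V c t²/2 - t u.
  set t := u / (V * c) with ht
  have ht0 : 0 < t := by positivity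
  -- Each coordinate is weighted by its share of the total variance. Rescaled by `√(w k)`, every
  -- coordinate with positive weight has squared coefficients summing to `V₁ ≤ V`, and averaging
  -- with weights of sum 1 removes the factor m. A coordinate of weight zero vanishes.
  set w : Fin m → ℝ := fun k => T k / V₁ with hw
  have hw0 : ∀ k, 0 ≤ w k := fun k => div_nonneg (hT0 k) hpos.le
  have hw1 : ∑ k, w k = 1 := by rw [hw, ← Finset.sum_div, hTsum, div_self hpos.ne']
  set a : Fin m → ι → ℝ := fun k e => x e k / Real.sqrt (w k) with ha
  have haV : ∀ k, ∑ e, a k e ^ 2 ≤ V := fun k => by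
    simp only [ha, div_pow, Real.sq_sqrt (hw0 k)]
    rw [← Finset.sum_div]
    change T k / (T k / V₁) ≤ V
    rcases (hT0 k).eq_or_lt with h | h
    · simp [← h, hV0.le]
    · rw [div_div_cancel₀ h.ne']; exact hV
  set g : Ω → ℝ := fun ω => ∑ k, w k * Real.cosh (t * ∑ e, a k e * ξ e ω) with hg
  have hgint : Integrable g μ :=
    integrable_finsetSum _ fun k _ => (integrable_cosh_sum_mul hind hξ (a k) t).const_mul _
  have hgle : ∫ ω, g ω ∂μ ≤ Real.exp (V * c * t ^ 2 / 2) := by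
    rw [integral_finsetSum _ fun k _ => (integrable_cosh_sum_mul hind hξ (a k) t).const_mul _]
    simp_rw [integral_const_mul]
    calc _ ≤ ∑ k, w k * Real.exp (V * c * t ^ 2 / 2) := by
          exact Finset.sum_le_sum fun k _ => mul_le_mul_of_nonneg_left
            (integral_cosh_sum_mul_le hind hξ (a k) (haV k) t) (hw0 k)
      _ = _ := by rw [← Finset.sum_mul, hw1, one_mul]
  have hg0 : ∀ ω, 0 ≤ g ω := fun ω =>
    Finset.sum_nonneg fun k _ => mul_nonneg (hw0 k) (Real.cosh_pos _).le
  have hsub : {ω | u ≤ ‖∑ e, ξ e ω • x e‖} ⊆ {ω | Real.exp (t * u) / 2 ≤ g ω} := by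
    intro ω hω
    have hcoord : ∀ k, (∑ e, ξ e ω • x e) k ^ 2 = w k * (∑ e, a k e * ξ e ω) ^ 2 := fun k => by
      rcases (hT0 k).eq_or_lt with h | h
      · have hx : ∀ e, x e k = 0 := fun e => by
          have := (Finset.sum_eq_zero_iff_of_nonneg fun e _ => sq_nonneg (x e k)).1 h.symm e
            (Finset.mem_univ e)
          simpa using this
        simp [ha, hx]
      · have hwk : 0 < w k := div_pos h hpos
        have : ∑ e, a k e * ξ e ω = (∑ e, ξ e ω • x e) k / Real.sqrt (w k) := by
          simp only [ha, WithLp.ofLp_sum, Finset.sum_apply, PiLp.smul_apply, smul_eq_mul,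
            Finset.sum_div]
          exact Finset.sum_congr rfl fun e _ => by ring
        rw [this, div_pow, Real.sq_sqrt hwk.le, mul_div_cancel₀ _ hwk.ne']
    have hJ := cosh_le_sum_mul_cosh (y := t * ‖∑ e, ξ e ω • x e‖)
      (z := fun k => t * ∑ e, a k e * ξ e ω) hw0 hw1 (by
        rw [mul_pow, EuclideanSpace.real_norm_sq_eq, Finset.mul_sum]
        refine Finset.sum_congr rfl fun k _ => ?_
        rw [hcoord]; ring)
    refine le_trans ?_ hJ
    -- The bound cosh y ≥ exp(y)/2 is the source of the factor 2 in the tail.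
    rw [Real.cosh_eq]
    have h1 : Real.exp (t * u) ≤ Real.exp (t * ‖∑ e, ξ e ω • x e‖) :=
      Real.exp_le_exp.2 (mul_le_mul_of_nonneg_left hω ht0.le)
    have h2 := Real.exp_pos (-(t * ‖∑ e, ξ e ω • x e‖))
    linarith
  have hmarkov := mul_meas_ge_le_integral_of_nonneg (.of_forall hg0) hgint (Real.exp (t * u) / 2)
  have hmono : μ.real {ω | u ≤ ‖∑ e, ξ e ω • x e‖} ≤ μ.real {ω | Real.exp (t * u) / 2 ≤ g ω} :=
    measureReal_mono hsub
  have hexp : Real.exp (V * c * t ^ 2 / 2) =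
      Real.exp (t * u) * Real.exp (-u ^ 2 / (2 * (V * c))) := by
    rw [← Real.exp_add, ht]
    congr 1
    field_simp
    ring
  have hle := hmarkov.trans (hgle.trans_eq hexp)
  have := Real.exp_pos (t * u)
  refine hmono.trans (le_of_mul_le_mul_left ?_ (half_pos this))
  linarith

lemma measureReal_le_abs_sum_mul (hind : iIndepFun ξ μ) (hξ : ∀ e, HasSubgaussianMGF (ξ e) c μ)
    (hc : 0 < c) {a : ι → ℝ} {V : ℝ} (hV0 : 0 < V) (hV : ∑ e, a e ^ 2 ≤ V) {u : ℝ} (hu : 0 < u) :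
    μ.real {ω | u ≤ |∑ e, a e * ξ e ω|} ≤ 2 * Real.exp (-u ^ 2 / (2 * (V * c))) := by
  have h := measureReal_le_norm_sum_smul (m := 1) hind hξ hc
    (fun e => EuclideanSpace.single 0 (a e)) hV0 (by simpa using hV) hu
  convert h using 6 with ω
  rw [EuclideanSpace.norm_eq]
  simp [Real.sqrt_sq_eq_abs, mul_comm]

end Concentration

end LowRankGLM

namespace LowRankGLM

/-! ### Deterministic error bounds for maximizers -/

lemma linPred_sub {n m : ℕ} (x : Fin n → Fin n → EuclideanSpace ℝ (Fin m))
    (Θ Θ' : Matrix (Fin n) (Fin n) ℝ) (β β' : EuclideanSpace ℝ (Fin m)) (i j : Fin n) :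
    linPred x Θ' β' i j - linPred x Θ β i j = Θ' i j - Θ i j + inner ℝ (x i j) (β' - β) := by
  simp only [linPred, Matrix.of_apply, PiLp.inner_apply, RCLike.inner_apply, conj_trivial,
    PiLp.sub_apply, sub_mul, Finset.sum_sub_distrib, mul_comm]
  ring

/-- The basic inequality for maximum likelihood estimators. -/
lemma frobNorm_sq_le_of_isMaximizer {n m : ℕ} {ν : Measure ℝ} [IsFiniteMeasure ν] [NeZero ν]
    {B : ℝ} (hB0 : 0 < B) (hB : ∀ᵐ a ∂ν, |a| ≤ B)
    {x : Fin n → Fin n → EuclideanSpace ℝ (Fin m)} {A Θ : Matrix (Fin n) (Fin n) ℝ}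
    {β : EuclideanSpace ℝ (Fin m)}
    {F : Set (Matrix (Fin n) (Fin n) ℝ × EuclideanSpace ℝ (Fin m))}
    {p : Matrix (Fin n) (Fin n) ℝ × EuclideanSpace ℝ (Fin m)} (hp : IsMaximizer ν x A F p)
    (hF : (Θ, β) ∈ F) :
    frobNorm (fittedMean ν x p.1 p.2 - fittedMean ν x Θ β) ^ 2 ≤ 2 * B ^ 2 *
      ∑ i, ∑ j, (A - fittedMean ν x Θ β) i j * (linPred x p.1 p.2 i j - linPred x Θ β i j) := by
  have hmax : 0 ≤ logLik ν x A p - logLik ν x A (Θ, β) := sub_nonneg.2 (hp.2 _ hF)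
  have hsum : ∑ i, ∑ j, (fittedMean ν x p.1 p.2 - fittedMean ν x Θ β) i j ^ 2 ≤
      2 * B ^ 2 * (∑ i, ∑ j, (A - fittedMean ν x Θ β) i j *
        (linPred x p.1 p.2 i j - linPred x Θ β i j)
        - (logLik ν x A p - logLik ν x A (Θ, β))) := by
    -- Entrywise, the Bregman divergence of b equals the noise times the predictor error, minus the
    -- log-likelihood gain.
    simp only [logLik, ← Finset.sum_sub_distrib, Finset.mul_sum]
    refine Finset.sum_le_sum fun i _ => Finset.sum_le_sum fun j _ => ?_
    refine (sq_invLink_sub_le hB0 hB (linPred x Θ β i j) (linPred x p.1 p.2 i j)).trans_eq ?_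
    simp only [fittedMean, Matrix.sub_apply, Matrix.map_apply]
    ring
  have hfrob : frobNorm (fittedMean ν x p.1 p.2 - fittedMean ν x Θ β) ^ 2 = _ :=
    Real.sq_sqrt (Finset.sum_nonneg fun i _ => Finset.sum_nonneg fun j _ => sq_nonneg _)
  rw [hfrob]
  refine hsum.trans (mul_le_mul_of_nonneg_left ?_ (by positivity))
  linarith

lemma sum_mul_linPred_sub_le {n m : ℕ} (x : Fin n → Fin n → EuclideanSpace ℝ (Fin m))
    (D Θ Θ' : Matrix (Fin n) (Fin n) ℝ) (β β' : EuclideanSpace ℝ (Fin m)) {w y R K : ℝ}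
    (hw0 : 0 ≤ w) (hw : ∀ v, ‖Matrix.toEuclideanLin D v‖ ≤ w * ‖v‖)
    (hy : ‖∑ e : Fin n × Fin n, D e.1 e.2 • x e.1 e.2‖ ≤ y)
    (hΘ : nuclearNorm Θ ≤ R) (hΘ' : nuclearNorm Θ' ≤ R) (hβ : ‖β‖ ≤ K) (hβ' : ‖β'‖ ≤ K) :
    ∑ i, ∑ j, D i j * (linPred x Θ' β' i j - linPred x Θ β i j) ≤ 2 * w * R + 2 * y * K := by
  -- Pairing D with Θ' and -D with Θ separately avoids the triangle inequality for the nuclear norm.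
  have h1 := sum_mul_le_mul_nuclearNorm D Θ' hw
  have h2 := sum_mul_le_mul_nuclearNorm (-D) Θ (c := w) fun v => by
    rw [map_neg, LinearMap.neg_apply, norm_neg]; exact hw v
  have h3 : inner ℝ (∑ e : Fin n × Fin n, D e.1 e.2 • x e.1 e.2) (β' - β) ≤ y * (K + K) :=
    (real_inner_le_norm _ _).trans (mul_le_mul hy ((norm_sub_le _ _).trans (by gcongr))
      (norm_nonneg _) ((norm_nonneg _).trans hy))
  have hsplit : ∑ i, ∑ j, D i j * (linPred x Θ' β' i j - linPred x Θ β i j) =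
      ∑ i, ∑ j, D i j * Θ' i j + ∑ i, ∑ j, (-D) i j * Θ i j +
        inner ℝ (∑ e : Fin n × Fin n, D e.1 e.2 • x e.1 e.2) (β' - β) := by
    simp only [linPred_sub, sum_inner, inner_smul_left, Fintype.sum_prod_type,
      ← Finset.sum_add_distrib, conj_trivial, Matrix.neg_apply]
    refine Finset.sum_congr rfl fun i _ => Finset.sum_congr rfl fun j _ => ?_
    ring
  have h4 := mul_le_mul_of_nonneg_left hΘ hw0
  have h5 := mul_le_mul_of_nonneg_left hΘ' hw0
  rw [hsplit]
  linarith

/-! ### Noise control and the tail bound in the model -/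

section Model

variable {n m : ℕ} {Ω : Type*} [MeasurableSpace Ω] {μ : Measure Ω} {ν : Measure ℝ}
  {x : Fin n → Fin n → EuclideanSpace ℝ (Fin m)} {Θ : Matrix (Fin n) (Fin n) ℝ}
  {β : EuclideanSpace ℝ (Fin m)} {A : Ω → Matrix (Fin n) (Fin n) ℝ} {B : ℝ}

lemma IsGLM.base [IsProbabilityMeasure μ] (hA : IsGLM μ ν x Θ β A) (hn : 1 ≤ n)
    (hB : ∀ i j, ∀ᵐ ω ∂μ, |A ω i j| ≤ B) :
    IsFiniteMeasure ν ∧ NeZero ν ∧ ∀ᵐ a ∂ν, |a| ≤ B := by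
  let i : Fin n := ⟨0, hn⟩
  refine base_of_expFamily (y := linPred x Θ β i i) ?_ ?_
  · rw [← hA.law i i]
    exact Measure.isProbabilityMeasure_map (hA.measurable i i).aemeasurable
  · rw [← hA.law i i]
    exact (ae_map_iff (p := fun a : ℝ => |a| ≤ B) (hA.measurable i i).aemeasurable
      (measurableSet_le measurable_norm measurable_const)).2 (hB i i)

lemma IsGLM.meanMatrix_eq [IsFiniteMeasure ν] (hA : IsGLM μ ν x Θ β A)
    (hB : ∀ᵐ a ∂ν, |a| ≤ B) : meanMatrix μ A = fittedMean ν x Θ β := by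
  ext i j
  rw [fittedMean, Matrix.map_apply, ← integral_expFamily hB, ← hA.law i j]
  exact (integral_map (f := fun a : ℝ => a) (hA.measurable i j).aemeasurable
    aestronglyMeasurable_id).symm

lemma IsGLM.iIndepFun_sub (hA : IsGLM μ ν x Θ β A) (P : Matrix (Fin n) (Fin n) ℝ) :
    iIndepFun (fun (e : Fin n × Fin n) ω => (A ω - P) e.1 e.2) μ :=
  hA.indep.comp (fun e a => a - P e.1 e.2) fun _ => measurable_id.sub_const _

lemma IsGLM.hasSubgaussianMGF [IsProbabilityMeasure μ] (hA : IsGLM μ ν x Θ β A) (hB0 : 0 ≤ B)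
    (hB : ∀ i j, ∀ᵐ ω ∂μ, |A ω i j| ≤ B) (e : Fin n × Fin n) :
    HasSubgaussianMGF (fun ω => (A ω - meanMatrix μ A) e.1 e.2) (B.toNNReal ^ 2) μ := by
  have h := hasSubgaussianMGF_of_mem_Icc (a := -B) (b := B)
    (hA.measurable e.1 e.2).aemeasurable ((hB e.1 e.2).mono fun _ ha => abs_le.1 ha)
  have hc : B.toNNReal ^ 2 = (‖B - -B‖₊ / 2) ^ 2 := by
    congr 1
    ext
    simp [hB0, abs_of_nonneg (add_nonneg hB0 hB0)]
  rw [hc]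
  exact h

lemma sum_sq_mul_le_one {u v : EuclideanSpace ℝ (Fin n)} (hu : ‖u‖ ≤ 1) (hv : ‖v‖ ≤ 1) :
    ∑ e : Fin n × Fin n, (u e.1 * v e.2) ^ 2 ≤ 1 := by
  have h : ∑ e : Fin n × Fin n, (u e.1 * v e.2) ^ 2 = ‖u‖ ^ 2 * ‖v‖ ^ 2 := by
    simp only [EuclideanSpace.real_norm_sq_eq, Fintype.sum_prod_type, mul_pow,
      ← Finset.mul_sum, ← Finset.sum_mul]
  rw [h, ← mul_pow]
  exact pow_le_one₀ (by positivity) (mul_le_one₀ hu (norm_nonneg _) hv)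

/-- The centred data matrix has operator norm below `4 * w`, and the covariates weighted with its
entries have a sum of norm below `n * K * w`, outside an event of small probability. -/
lemma IsGLM.exists_exceptional_set [IsProbabilityMeasure μ] (hA : IsGLM μ ν x Θ β A)
    (hn : 1 ≤ n) (hB0 : 0 < B) (hB : ∀ i j, ∀ᵐ ω ∂μ, |A ω i j| ≤ B) {K : ℝ} (hK : 0 < K)
    (hx : ∀ i j, ‖x i j‖ ≤ K) {w : ℝ} (hw : 0 < w) :
    ∃ S : Set Ω, μ.real S ≤ 4 * 25 ^ n * Real.exp (-w ^ 2 / (2 * B ^ 2)) ∧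
      ∀ ω ∉ S, (∀ v, ‖Matrix.toEuclideanLin (A ω - meanMatrix μ A) v‖ ≤ 4 * w * ‖v‖) ∧
        ‖∑ e : Fin n × Fin n, (A ω - meanMatrix μ A) e.1 e.2 • x e.1 e.2‖ ≤ n * K * w := by
  obtain ⟨N, hNcard, hN1, hN⟩ := exists_half_net (EuclideanSpace ℝ (Fin n))
  rw [finrank_euclideanSpace_fin] at hNcard
  have hn0 : (0 : ℝ) < n := by exact_mod_cast hn
  have hind := hA.iIndepFun_sub (meanMatrix μ A)
  have hsub := hA.hasSubgaussianMGF hB0.le hB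
  have hc : 0 < B.toNNReal ^ 2 := by positivity
  have hcB : ((B.toNNReal ^ 2 : NNReal) : ℝ) = B ^ 2 := by simp [hB0.le]
  set D : Ω → Matrix (Fin n) (Fin n) ℝ := fun ω => A ω - meanMatrix μ A with hD
  set S₁ : EuclideanSpace ℝ (Fin n) × EuclideanSpace ℝ (Fin n) → Set Ω := fun q =>
    {ω | w ≤ |∑ e : Fin n × Fin n, q.1 e.1 * q.2 e.2 * D ω e.1 e.2|} with hS₁
  set S₂ : Set Ω := {ω | n * K * w ≤ ‖∑ e : Fin n × Fin n, D ω e.1 e.2 • x e.1 e.2‖} with hS₂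
  set η := Real.exp (-w ^ 2 / (2 * B ^ 2)) with hη
  have hη0 : 0 < η := Real.exp_pos _
  have h1 : ∀ q ∈ N ×ˢ N, μ.real (S₁ q) ≤ 2 * η := by
    intro q hq
    rw [Finset.mem_product] at hq
    have := measureReal_le_abs_sum_mul hind hsub hc one_pos
      (sum_sq_mul_le_one (hN1 _ hq.1) (hN1 _ hq.2)) hw
    rwa [one_mul, hcB] at this
  have h2 : μ.real S₂ ≤ 2 * η := by
    -- Threshold and variance scale together, so the exponent equals that of the bilinear forms.
    have := measureReal_le_norm_sum_smul hind hsub hc (fun e => x e.1 e.2) (V := (n * K) ^ 2)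
      (by positivity) (by
        calc ∑ e : Fin n × Fin n, ‖x e.1 e.2‖ ^ 2 ≤ ∑ _e : Fin n × Fin n, K ^ 2 :=
              Finset.sum_le_sum fun e _ => pow_le_pow_left₀ (norm_nonneg _) (hx _ _) 2
          _ = (n * K) ^ 2 := by simp; ring) (u := n * K * w) (by positivity)
    refine this.trans_eq ?_
    rw [hcB, hη]
    congr 2
    field_simp
  refine ⟨(⋃ q ∈ N ×ˢ N, S₁ q) ∪ S₂, ?_, fun ω hω => ?_⟩
  · have hcard : ((N ×ˢ N).card : ℝ) ≤ 25 ^ n := by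
      rw [Finset.card_product, show (25 : ℝ) = 5 * 5 by norm_num, mul_pow]
      push_cast
      have : (N.card : ℝ) ≤ 5 ^ n := by exact_mod_cast hNcard
      gcongr
    have h25 : (1 : ℝ) ≤ 25 ^ n := one_le_pow₀ (by norm_num)
    calc _ ≤ μ.real (⋃ q ∈ N ×ˢ N, S₁ q) + μ.real S₂ := measureReal_union_le _ _
      _ ≤ ∑ q ∈ N ×ˢ N, μ.real (S₁ q) + 2 * η := by
        gcongr
        exact measureReal_biUnion_finset_le _ _
      _ ≤ (N ×ˢ N).card * (2 * η) + 2 * η := by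
        gcongr
        simpa using Finset.sum_le_card_nsmul _ _ _ h1
      _ ≤ 25 ^ n * (2 * η) + 25 ^ n * (2 * η) := by
        exact add_le_add (mul_le_mul_of_nonneg_right hcard (by positivity))
          (le_mul_of_one_le_left (by positivity) h25)
      _ = _ := by ring
  · simp only [Set.mem_union, Set.mem_iUnion, not_or, not_exists] at hω
    refine ⟨norm_toEuclideanLin_le_of_net hN _ fun u hu v hv => ?_, (not_le.1 hω.2).le⟩
    have h := hω.1 (u, v) (Finset.mk_mem_product hu hv)
    rw [hS₁, Set.mem_ofPred_eq, not_le, Fintype.sum_prod_type] at h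
    exact h.le

/-- Tail bound for every maximum likelihood estimator over a feasible set that contains the truth
and has bounded nuclear norm. -/
lemma IsGLM.measureReal_scaledError_le [IsProbabilityMeasure μ] (hA : IsGLM μ ν x Θ β A)
    (hn : 1 ≤ n) (hB1 : 1 ≤ B) (hB : ∀ i j, ∀ᵐ ω ∂μ, |A ω i j| ≤ B) {K Kβ ρ G : ℝ} (hK : 1 ≤ K)
    (hx : ∀ i j, ‖x i j‖ ≤ K) (hβ : ‖β‖ ≤ Kβ) {R : ℝ} (hR : R ≤ ρ * n)
    (hG0 : 0 < G) (hG : 16 * B ^ 2 * ρ + 4 * B ^ 2 * K * Kβ < G)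
    {F : Set (Matrix (Fin n) (Fin n) ℝ × EuclideanSpace ℝ (Fin m))} (hF : (Θ, β) ∈ F)
    (hFR : ∀ p ∈ F, nuclearNorm p.1 ≤ R) {t : ℝ} (ht : 0 < t) :
    μ.real {ω | ∃ p, IsMaximizer ν x (A ω) F p ∧ ‖p.2‖ ≤ Kβ ∧
        t ≤ scaledError ν x (meanMatrix μ A) p} ≤
      4 * Real.exp (-(1 / (2 * B ^ 2 * G ^ 2)) *
        (max 0 (n * t ^ 2 - 4 * B * G * Real.sqrt n)) ^ 2) := by
  have hn0 : (0 : ℝ) < n := by exact_mod_cast hn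
  have hB0 : 0 < B := one_pos.trans_le hB1
  -- If the positive part vanishes, the bound is 4 and hence trivial.
  rcases le_or_gt (n * t ^ 2 - 4 * B * G * Real.sqrt n) 0 with hq | hq
  · rw [max_eq_left hq]
    refine measureReal_le_one.trans ?_
    norm_num
  rw [max_eq_right hq.le]
  obtain ⟨_, _, hBν⟩ := hA.base hn hB
  -- With this choice (nt)² = n w G, while off the exceptional set the basic inequality gives at
  -- most (16B²ρ + 4B²K Kβ) n w, which is strictly smaller.
  set w := n * t ^ 2 / G with hw
  have hw0 : 0 < w := by positivity
  obtain ⟨S, hS, hgood⟩ := hA.exists_exceptional_set hn hB0 hB (one_pos.trans_le hK) hx hw0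
  -- The event ranges over all maximizers and is not shown to be measurable; inclusion in S
  -- suffices.
  have hsub : {ω | ∃ p, IsMaximizer ν x (A ω) F p ∧ ‖p.2‖ ≤ Kβ ∧
      t ≤ scaledError ν x (meanMatrix μ A) p} ⊆ S := by
    rintro ω ⟨p, hp, hpβ, hpt⟩
    by_contra hω
    obtain ⟨hop, hlin⟩ := hgood ω hω
    have h1 := frobNorm_sq_le_of_isMaximizer hB0 hBν hp hF
    rw [← hA.meanMatrix_eq hBν] at h1
    have h2 := sum_mul_linPred_sub_le x (A ω - meanMatrix μ A) Θ p.1 β p.2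
      (mul_pos four_pos hw0).le hop hlin (hFR (Θ, β) hF) (hFR p hp.1) hβ hpβ
    have h3 : (n * t) ^ 2 ≤ frobNorm (fittedMean ν x p.1 p.2 - meanMatrix μ A) ^ 2 := by
      refine pow_le_pow_left₀ (by positivity) ?_ 2
      rw [scaledError, inv_mul_eq_div, le_div_iff₀ hn0] at hpt
      linarith
    have h4 : (n * t) ^ 2 ≤ 2 * B ^ 2 * (2 * (4 * w) * (ρ * n) + 2 * (n * K * w) * Kβ) := by
      refine (h3.trans h1).trans (mul_le_mul_of_nonneg_left (h2.trans ?_) (by positivity))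
      gcongr
    have h5 : (n * t) ^ 2 = n * w * G := by rw [hw]; field_simp
    have h6 := mul_lt_mul_of_pos_left hG (mul_pos hn0 hw0)
    linarith
  refine (measureReal_mono hsub).trans (hS.trans ?_)
  rw [mul_assoc]
  refine mul_le_mul_of_nonneg_left ?_ (by norm_num)
  have h25 : (25 : ℝ) ^ n ≤ Real.exp (8 * n) := by
    rw [mul_comm, Real.exp_nat_mul]
    refine pow_le_pow_left₀ (by norm_num) ?_ n
    have h2 : (2 : ℝ) ≤ Real.exp 1 := by linarith [Real.add_one_le_exp (1 : ℝ)]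
    have := pow_le_pow_left₀ (by norm_num) h2 8
    rw [← Real.exp_nat_mul] at this
    norm_num at this
    linarith
  refine (mul_le_mul_of_nonneg_right h25 (Real.exp_pos _).le).trans ?_
  rw [← Real.exp_add, Real.exp_le_exp]
  set q := n * t ^ 2 - 4 * B * G * Real.sqrt n with hqdef
  have hwG : w = (q + 4 * B * G * Real.sqrt n) / G := by rw [hw, hqdef]; ring
  have hsq : Real.sqrt n ^ 2 = n := Real.sq_sqrt hn0.le
  -- The shift 4BG√n is chosen so that its square contributes exactly 8n, which cancels 25^n ≤
  -- exp(8n). The cross term is nonnegative and is dropped.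
  have hkey : w ^ 2 / (2 * B ^ 2) =
      q ^ 2 / (2 * B ^ 2 * G ^ 2) + 4 * q * Real.sqrt n / (B * G) + 8 * n := by
    rw [hwG]
    nth_rewrite 3 [← hsq]
    field_simp
    ring
  have hcross : 0 ≤ 4 * q * Real.sqrt n / (B * G) := by positivity
  rw [neg_div, hkey, neg_mul, one_div_mul_eq_div]
  linarith

end Model

end LowRankGLM

theorem corollary2 (B Kθ Kβ Kx ρ : ℝ) (r : ℕ) :
    ∃ C₀ C₁ c : ℝ, 0 < C₀ ∧ 0 < C₁ ∧ 0 < c ∧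
      ∀ (n m : ℕ) (Ω : Type*) (_ : MeasurableSpace Ω) (μ : Measure Ω) (_ : IsProbabilityMeasure μ)
        (ν : Measure ℝ) (x : Fin n → Fin n → EuclideanSpace ℝ (Fin m))
        (Θ : Matrix (Fin n) (Fin n) ℝ) (β : EuclideanSpace ℝ (Fin m))
        (A : Ω → Matrix (Fin n) (Fin n) ℝ) (R : ℝ) (𝓑 : Set (EuclideanSpace ℝ (Fin m))),
        1 ≤ n →
        LowRankGLM.IsGLM μ ν x Θ β A →
        (∀ i j, |Θ i j| ≤ Kθ) → Θ.rank ≤ r →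
        ‖β‖ ≤ Kβ →
        (∀ i j, ‖x i j‖ ≤ Kx) →
        (∀ i j, ∀ᵐ ω ∂μ, |A ω i j| ≤ B) →
        Real.sqrt r * n * Kθ ≤ R → R ≤ ρ * n →
        β ∈ 𝓑 →
        (∀ t : ℝ, 0 < t →
          μ.real {ω | ∃ p, LowRankGLM.IsMaximizer ν x (A ω) (LowRankGLM.relaxedSet n R 𝓑) p ∧
              ‖p.2‖ ≤ Kβ ∧ t ≤ LowRankGLM.scaledError ν x (LowRankGLM.meanMatrix μ A) p}
            ≤ C₁ * Real.exp (-c * (max 0 (n * t ^ 2 - C₀ * Real.sqrt n)) ^ 2)) ∧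
        (∀ s : ℕ, r ≤ s → ∀ t : ℝ, 0 < t →
          μ.real {ω | ∃ p, LowRankGLM.IsMaximizer ν x (A ω) (LowRankGLM.truncatedSet n R s 𝓑) p ∧
              ‖p.2‖ ≤ Kβ ∧ t ≤ LowRankGLM.scaledError ν x (LowRankGLM.meanMatrix μ A) p}
            ≤ C₁ * Real.exp (-c * (max 0 (n * t ^ 2 - C₀ * Real.sqrt n)) ^ 2)) := by
  -- The given constants may have any sign; the maxima and absolute values make the new ones usable,
  -- and the final 1 in `G` makes its bound strict. Neither Kθ nor r enters.
  set B' := max B 1 with hB'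
  set K := max Kx 1 with hK
  set G := 16 * B' ^ 2 * |ρ| + 4 * B' ^ 2 * K * |Kβ| + 1 with hG
  have hB1 : 1 ≤ B' := le_max_right _ _
  have hK1 : 1 ≤ K := le_max_right _ _
  have hG0 : 0 < G := by positivity
  refine ⟨4 * B' * G, 4, 1 / (2 * B' ^ 2 * G ^ 2), by positivity, by norm_num, by positivity, ?_⟩
  intro n m Ω _ μ _ ν x Θ β A R 𝓑 hn hA hΘ hrank hβ hx hB hR hRρ hβ𝓑
  have hn0 : (0 : ℝ) ≤ n := n.cast_nonneg
  have hKθ : 0 ≤ Kθ := (abs_nonneg _).trans (hΘ ⟨0, hn⟩ ⟨0, hn⟩)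
  -- The rank and entry bounds on Θ serve to make the truth feasible.
  have hnuc : LowRankGLM.nuclearNorm Θ ≤ R := by
    refine (LowRankGLM.nuclearNorm_le_sqrt_rank_mul_frobNorm Θ).trans (le_trans ?_ hR)
    rw [mul_assoc]
    exact mul_le_mul (Real.sqrt_le_sqrt (by exact_mod_cast hrank))
      (LowRankGLM.frobNorm_le_mul hKθ hΘ) (Real.sqrt_nonneg _) (Real.sqrt_nonneg _)
  have hBB' : ∀ i j, ∀ᵐ ω ∂μ, |A ω i j| ≤ B' := fun i j =>
    (hB i j).mono fun _ h => h.trans (le_max_left _ _)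
  have hxK : ∀ i j, ‖x i j‖ ≤ K := fun i j => (hx i j).trans (le_max_left _ _)
  have hRρ' : R ≤ |ρ| * n := hRρ.trans (mul_le_mul_of_nonneg_right (le_abs_self ρ) hn0)
  have hGlt : 16 * B' ^ 2 * |ρ| + 4 * B' ^ 2 * K * Kβ < G := by
    have := mul_le_mul_of_nonneg_left (le_abs_self Kβ) (show 0 ≤ 4 * B' ^ 2 * K by positivity)
    linarith
  refine ⟨fun t ht => ?_, fun s hs t ht => ?_⟩
  · exact hA.measureReal_scaledError_le hn hB1 hBB' hK1 hxK hβ hRρ' hG0 hGlt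
      (F := LowRankGLM.relaxedSet n R 𝓑) ⟨hnuc, hβ𝓑⟩ (fun p hp => hp.1) ht
  · exact hA.measureReal_scaledError_le hn hB1 hBB' hK1 hxK hβ hRρ' hG0 hGlt
      (F := LowRankGLM.truncatedSet n R s 𝓑) ⟨hnuc, hrank.trans hs, hβ𝓑⟩ (fun p hp => hp.1) ht
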